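/- Let $q$ be a prime power, $\mathbb F_q$ the field with $q$ elements, $n\ge 0$, and let $GA_n(\mathbb F_q)$ be the group, under composition, of invertible polynomial maps $f=(f_1,\dots,f_n)$ with $f_i\in\mathbb F_q[X_1,\dots,X_n]$. Let $GA_n(\mathbb F_q)^{(q)}$ be the set of those $f\in GA_n(\mathbb F_q)$ all of whose components $f_i$ are linearized, i.e. $\mathbb F_q$-linear combinations of the monomials $X_j^{q^m}$ ($1\le j\le n$, $m\ge 0$). (1) If $f\in GA_n(\mathbb F_q)^{(q)}$ has finite order $d$ in $GA_n(\mathbb F_q)$ and $\gcd(d,q)=1$, then $f$ is linearizable: there are $h\in GA_n(\mathbb F_q)$ and $A\in GL_n(\mathbb F_q)$ such that $h\circ f\circ h^{-1}$ is the linear automorphism $\bigl(\sum_j A_{1j}X_j,\dots,\sum_j A_{nj}X_j\bigr)$. (2) Let $K$ be any field, $n,d\ge 0$ integers, and $A\in GL_n(K[t])$ with $A^d=I_n$ and $\operatorname{char} K\nmid d$. Then there is $B\in GL_n(K[t])$ such that $B^{-1}AB\in GL_n(K)$, i.e. $B^{-1}AB$ is a constant matrix. -/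

import Mathlib

namespace LinearizedMaps

/-- A polynomial map `f = (f_1, …, f_n)` in `n` variables over `K`: a list of `n` polynomials in
`K[X_1, …, X_n]`. -/
@[ext]
structure PolyMap (n : ℕ) (K : Type*) [CommRing K] where
  /-- The components of the polynomial map. -/
  comp : Fin n → MvPolynomial (Fin n) K

namespace PolyMap

variable {n : ℕ} {K : Type*} [CommRing K]

/-- Polynomial maps form a monoid under composition: the product `f * g` is
`f ∘ g = (f_1(g_1, …, g_n), …, f_n(g_1, …, g_n))`, and the unit is `(X_1, …, X_n)`. -/
noncomputable instance : Monoid (PolyMap n K) where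
  mul f g := ⟨fun i => MvPolynomial.bind₁ g.comp (f.comp i)⟩
  one := ⟨fun i => MvPolynomial.X i⟩
  mul_assoc f g h := by
    ext1
    funext i
    exact MvPolynomial.bind₁_bind₁ g.comp h.comp (f.comp i)
  one_mul f := by
    ext1
    funext i
    exact MvPolynomial.bind₁_X_right f.comp i
  mul_one f := by
    ext1
    funext i
    exact congrArg (fun φ : MvPolynomial (Fin n) K →ₐ[K] MvPolynomial (Fin n) K => φ (f.comp i))
      MvPolynomial.bind₁_X_left

theorem mul_comp (f g : PolyMap n K) (i : Fin n) :
    (f * g).comp i = MvPolynomial.bind₁ g.comp (f.comp i) := rfl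

theorem one_comp (i : Fin n) : (1 : PolyMap n K).comp i = MvPolynomial.X i := rfl

/-- The linear polynomial map with matrix `A`: its `i`-th component is `∑ j, A i j * X_j`. -/
noncomputable def linear : Matrix (Fin n) (Fin n) K →* PolyMap n K where
  toFun A := ⟨fun i => ∑ j, MvPolynomial.C (A i j) * MvPolynomial.X j⟩
  map_one' := by
    ext1
    funext i
    simp [one_comp, Matrix.one_apply]
  map_mul' A B := by
    ext1
    funext i
    simp only [mul_comp, Matrix.mul_apply, map_sum, map_mul, MvPolynomial.bind₁_C_right,
      MvPolynomial.bind₁_X_right, Finset.sum_mul, Finset.mul_sum, mul_assoc]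
    exact Finset.sum_comm

end PolyMap

/-- The group `GA_n(K)` of automorphisms (invertible polynomial maps): the units of the monoid of
polynomial maps under composition. -/
abbrev GA (n : ℕ) (K : Type*) [CommRing K] : Type _ := (PolyMap n K)ˣ

/-- The group homomorphism `GL_n(K) → GA_n(K)` which sends a matrix to its linear automorphism. -/
noncomputable def linearAut {n : ℕ} {K : Type*} [CommRing K] :
    Matrix.GeneralLinearGroup (Fin n) K →* GA n K :=
  Units.map PolyMap.linear

/-- An automorphism is linearizable if it is conjugate, in `GA_n(K)`, to a linear automorphism. -/
def IsLinearizable {n : ℕ} {K : Type*} [CommRing K] (f : GA n K) : Prop :=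
  ∃ A : Matrix.GeneralLinearGroup (Fin n) K, IsConj f (linearAut A)

/-- The `K`-space `K[X_1, …, X_n]^(q)` of linearized polynomials, spanned by the monomials
`X_i ^ (q ^ m)` with `m ≥ 0`. -/
noncomputable def linearizedPoly (n : ℕ) (K : Type*) [CommRing K] (q : ℕ) :
    Submodule K (MvPolynomial (Fin n) K) :=
  Submodule.span K {p | ∃ (i : Fin n) (m : ℕ), p = MvPolynomial.X i ^ q ^ m}

/-- The set `GA_n(K)^(q)` of those automorphisms all of whose components are linearized
polynomials. -/
def linearizedGA (n : ℕ) (K : Type*) [CommRing K] (q : ℕ) : Set (GA n K) :=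
  {f | ∀ i, f.val.comp i ∈ linearizedPoly n K q}

end LinearizedMaps

/-! ### Endomorphisms over `K[t]` killed by a squarefree constant polynomial. -/

section ConstantMatrix

open Polynomial Module

/-! Over `F = F_q`, let `t` act on polynomials as the `q`-power Frobenius. Linearized maps then
become matrices over `F[t]`, faithfully and with composition as matrix product (`linearizedMap`,
`linearizedMap_injective`), and constant matrices give linear maps. So (1) follows from (2).

For (2), `X ^ d - 1` is squarefree over `K`, so `K[t]^n` is the direct sum of the kernels of `p(A)`
for its irreducible factors `p` (`of_squarefree`). On each kernel `A` acts as the root of `p` in `L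
= K[X]/(p)`. The kernel is a finite torsion-free module over the PID `L[t]`, hence free, and
multiplication by an element of `L` is constant in a basis built from a `K`-basis of `L`
(`of_irreducible`). -/

/-- An endomorphism of a finite free module over `K[X]` has a constant matrix if its matrix in some
basis has all its entries in `K`. -/
def HasConstantMatrix {K M : Type*} [Field K] [AddCommGroup M] [Module K[X] M]
    (f : Module.End K[X] M) : Prop :=
  ∃ (m : ℕ) (b : Basis (Fin m) K[X] M) (C : Matrix (Fin m) (Fin m) K),
    LinearMap.toMatrix b b f = C.map Polynomial.C

namespace HasConstantMatrix

variable {K M N : Type*} [Field K] [AddCommGroup M] [Module K[X] M] [AddCommGroup N] [Module K[X] N]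

theorem of_basis {ι : Type*} [Fintype ι] [DecidableEq ι] {f : Module.End K[X] M}
    (b : Basis ι K[X] M) (C : Matrix ι ι K) (h : LinearMap.toMatrix b b f = C.map Polynomial.C) :
    HasConstantMatrix f := by
  let e := Fintype.equivFin ι
  refine ⟨_, b.reindex e, C.reindex e e, ?_⟩
  ext1 i j
  have := congrFun₂ h (e.symm i) (e.symm j)
  simpa [LinearMap.toMatrix_apply] using! this

theorem prodMap {f : Module.End K[X] M} {g : Module.End K[X] N} (hf : HasConstantMatrix f)
    (hg : HasConstantMatrix g) : HasConstantMatrix (f.prodMap g) := by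
  obtain ⟨m, b, B, hB⟩ := hf
  obtain ⟨n, c, C, hC⟩ := hg
  refine of_basis (b.prod c) (Matrix.fromBlocks B 0 0 C) ?_
  rw [LinearMap.toMatrix_prodMap, hB, hC, Matrix.fromBlocks_map]
  simp

theorem of_linearEquiv {f : Module.End K[X] M} {g : Module.End K[X] N} (e : M ≃ₗ[K[X]] N)
    (h : ∀ x, e (f x) = g (e x)) (hf : HasConstantMatrix f) : HasConstantMatrix g := by
  obtain ⟨m, b, B, hB⟩ := hf
  refine ⟨m, b.map e, B, ?_⟩
  rw [← hB]
  ext1 i j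
  simp [LinearMap.toMatrix_apply, ← h]

/-- The module is free over `L[X]` for the field `L = K[X]/(p)`, and multiplication by the root of
`p` has a constant matrix with respect to the product of a `K`-basis of `L` with an `L[X]`-basis of
the module. -/
theorem of_irreducible [Module.Finite K[X] M] [IsTorsionFree K[X] M] {p : K[X]}
    (hp : Irreducible p) {f : Module.End K[X] M} (hf : aeval f (p.map Polynomial.C) = 0) :
    HasConstantMatrix f := by
  have : Fact (Irreducible p) := ⟨hp⟩
  let pb := AdjoinRoot.powerBasis hp.ne_zero
  have : Module.Finite K (AdjoinRoot p) := pb.finite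
  -- In `K[X][X]` the inner variable is `t` and the outer one is evaluated at `f`; thus the root of
  -- `p` acts as `f`.
  let φ : AdjoinRoot p →+* Module.End K[X] M :=
    Ideal.Quotient.lift (Ideal.span {p})
      ((aeval f : K[X][X] →ₐ[K[X]] Module.End K[X] M).toRingHom.comp (mapRingHom Polynomial.C))
      (by
        intro a ha
        obtain ⟨c, rfl⟩ := Ideal.mem_span_singleton.mp ha
        simp [hf])
  let := Polynomial.algebra K (AdjoinRoot p)
  have hφ (a : K[X]) : φ (AdjoinRoot.mk p a) = aeval f (a.map Polynomial.C) :=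
    Ideal.Quotient.lift_mk _ _ _
  let ψ : (AdjoinRoot p)[X] →+* Module.End K[X] M :=
    eval₂RingHom' φ (algebraMap K[X] _ X) fun a => (Algebra.commutes _ _).symm
  have hψC (a : AdjoinRoot p) : ψ (Polynomial.C a) = φ a := eval₂_C _ _
  have hψX : ψ X = algebraMap K[X] _ X := eval₂_X _ _
  have hψ : ψ.comp (algebraMap K[X] (AdjoinRoot p)[X]) = algebraMap K[X] (Module.End K[X] M) := by
    refine Polynomial.ringHom_ext (fun a => ?_) ?_
    · rw [RingHom.comp_apply, algebraMap_def, coe_mapRingHom, map_C, hψC, AdjoinRoot.algebraMap_eq,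
        ← AdjoinRoot.mk_C, hφ, map_C, aeval_C]
    · rw [RingHom.comp_apply, algebraMap_def, coe_mapRingHom, map_X, hψX]
  let : Module (AdjoinRoot p)[X] M := Module.compHom M ψ
  have smul_def (x : (AdjoinRoot p)[X]) (m : M) : x • m = ψ x m := rfl
  have : IsScalarTower K[X] (AdjoinRoot p)[X] M := by
    refine .of_algebraMap_smul fun r m => ?_
    rw [smul_def, ← RingHom.comp_apply, hψ, Module.algebraMap_end_apply]
  have : Module.Finite (AdjoinRoot p)[X] M := .of_restrictScalars_finite K[X] _ _
  have : IsTorsionFree (AdjoinRoot p)[X] M := by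
    refine .of_smul_eq_zero fun x m hxm => ?_
    by_contra! h
    -- `L[t]` is integral over `K[t]`, so `x ≠ 0` divides some nonzero `r` in `K[t]`, and
    -- torsion-freeness over `K[t]` applies.
    obtain ⟨r, hr, y, hy⟩ := (Algebra.IsIntegral.isIntegral (R := K[X]) x).isAlgebraic
      |>.exists_nonzero_dvd (mem_nonZeroDivisors_of_ne_zero h.1)
    have : r • m = 0 := by
      rw [← algebraMap_smul (AdjoinRoot p)[X] r m, hy, mul_comm, mul_smul, hxm, smul_zero]
    exact (smul_eq_zero.mp this).elim hr h.2
  have hpush : IsBaseChange K[X]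
      (IsScalarTower.toAlgHom K (AdjoinRoot p) (AdjoinRoot p)[X]).toLinearMap :=
    (inferInstance : Algebra.IsPushout K K[X] (AdjoinRoot p) (AdjoinRoot p)[X]).out
  let b₁ := hpush.basis pb.basis
  have hb₁ (i) : b₁ i = Polynomial.C (pb.basis i) := by
    simp [b₁, IsBaseChange.basis_apply, Polynomial.algebraMap_eq]
  let b₂ := Module.Free.chooseBasis (AdjoinRoot p)[X] M
  refine of_basis (b₁.smulTower b₂)
    (.of fun i j =>
      if i.2 = j.2 then Algebra.leftMulMatrix pb.basis (AdjoinRoot.root p) i.1 j.1 else 0) ?_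
  have hfm (m : M) : f m = Polynomial.C (AdjoinRoot.root p) • m := by
    rw [smul_def, hψC, ← AdjoinRoot.mk_X, hφ, map_X, aeval_X]
  ext1 ⟨i, k⟩ ⟨j, l⟩
  rw [LinearMap.toMatrix_apply, hfm, Basis.smulTower_repr, Basis.smulTower_apply, smul_smul,
    map_smul, Basis.repr_self, Finsupp.smul_single, Matrix.map_apply, Matrix.of_apply, hb₁, smul_eq_mul, mul_one, ← Polynomial.C_mul]
  have key : b₁.repr (Polynomial.C (AdjoinRoot.root p * pb.basis j)) i =
      Polynomial.C (pb.basis.repr (AdjoinRoot.root p * pb.basis j) i) := by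
    have : Polynomial.C (AdjoinRoot.root p * pb.basis j) =
        ∑ i, Polynomial.C (pb.basis.repr (AdjoinRoot.root p * pb.basis j) i) • b₁ i := by
      conv_lhs => rw [← pb.basis.sum_repr (AdjoinRoot.root p * pb.basis j)]
      rw [map_sum]
      refine Finset.sum_congr rfl fun i _ => ?_
      rw [hb₁, Algebra.smul_def, Algebra.smul_def, Polynomial.C_mul]
      simp
    rw [this, Basis.repr_sum_self]
  by_cases h : k = l
  · subst h
    simpa [Algebra.leftMulMatrix_eq_repr_mul] using key
  · simp [h]

theorem of_subsingleton [Subsingleton M] (f : Module.End K[X] M) : HasConstantMatrix f :=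
  ⟨0, Basis.empty M, 0, by ext1 i; exact i.elim0⟩

theorem of_isUnit {p : K[X]} (hp : IsUnit p) {f : Module.End K[X] M}
    (hf : aeval f (p.map Polynomial.C) = 0) : HasConstantMatrix f := by
  have h1 : (1 : Module.End K[X] M) = 0 := by
    have := (hp.map (mapRingHom (Polynomial.C : K →+* K[X]))).map (aeval f)
    rw [coe_mapRingHom, hf, isUnit_zero_iff] at this
    exact this.symm
  have : Subsingleton M := subsingleton_of_forall_eq 0 fun x => congr($h1 x)
  exact of_subsingleton f

theorem aeval_restrict_apply {R M : Type*} [CommRing R] [AddCommGroup M] [Module R M]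
    {f : Module.End R M} {U : Submodule R M} (hU : ∀ x ∈ U, f x ∈ U) (p : R[X]) (x : U) :
    (aeval (f.restrict hU) p x : M) = aeval f p x := by
  have h (k : ℕ) : (((f.restrict hU) ^ k) x : M) = (f ^ k) x := by
    induction k with
    | zero => rfl
    | succ k ih => simp [pow_succ', ih]
  induction p using Polynomial.induction_on' with
  | add p q hp hq => simp [hp, hq]
  | monomial k a => simp [aeval_monomial, h]

/-- The module stays quantified inside the induction, because the hypotheses for coprime factors are
applied to the two kernels. -/
theorem of_squarefree {p : K[X]} (hp : Squarefree p) :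
    ∀ {M : Type*} [AddCommGroup M] [Module K[X] M] [Module.Finite K[X] M] [IsTorsionFree K[X] M]
      {f : Module.End K[X] M}, aeval f (p.map Polynomial.C) = 0 → HasConstantMatrix f := by
  induction p using UniqueFactorizationMonoid.induction_on_coprime with
  | h0 => exact absurd hp not_squarefree_zero
  | h1 hu => exact of_isUnit hu
  | @hpr p i hp' =>
    obtain rfl | rfl := hp.eq_zero_or_one_of_pow_of_not_isUnit hp'.not_isUnit
    · exact of_isUnit (by simp)
    · exact of_irreducible (by simpa using hp'.irreducible)
  | @hcp p q hpq ihp ihq =>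
    intro M _ _ _ _ f hf
    have hcop : IsCoprime (p.map (Polynomial.C : K →+* K[X])) (q.map Polynomial.C) :=
      (isRelPrime_iff_isCoprime.mp hpq).map (mapRingHom Polynomial.C)
    rw [Polynomial.map_mul] at hf
    let U (r : K[X]) : Submodule K[X] M := LinearMap.ker (aeval f (r.map Polynomial.C))
    have hU (r : K[X]) : ∀ x ∈ U r, f x ∈ U r := by
      intro x hx
      have h := congr(aeval f $(mul_comm (r.map (Polynomial.C : K →+* K[X])) X) x)
      rw [LinearMap.mem_ker] at hx ⊢
      simpa [hx] using h
    have hc : IsCompl (U p) (U q) := by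
      refine ⟨disjoint_ker_aeval_of_isCoprime f hcop, ?_⟩
      rw [codisjoint_iff, sup_ker_aeval_eq_ker_aeval_mul_of_coprime f hcop, hf, LinearMap.ker_zero]
    have hr (r : K[X]) : aeval (f.restrict (hU r)) (r.map Polynomial.C) = 0 := by
      ext x
      rw [aeval_restrict_apply]
      exact x.2
    refine of_linearEquiv (Submodule.prodEquivOfIsCompl _ _ hc) ?_
      ((ihp (hp.of_mul_left) (hr p)).prodMap (ihq (hp.of_mul_right) (hr q)))
    intro x
    simp

end HasConstantMatrix

theorem exists_conj_eq_map_C {K : Type*} [Field K] {n d : ℕ}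
    (A : Matrix.GeneralLinearGroup (Fin n) K[X]) (hA : A ^ d = 1) (hd : ¬ ringChar K ∣ d) :
    ∃ (B : Matrix.GeneralLinearGroup (Fin n) K[X]) (C : Matrix.GeneralLinearGroup (Fin n) K),
      B⁻¹ * A * B = Matrix.GeneralLinearGroup.map (Polynomial.C : K →+* K[X]) C := by
  -- `hd` also rules out `d = 0`, since everything divides `0`.
  have hsep : Squarefree (X ^ d - 1 : K[X]) :=
    (X_pow_sub_one_separable_iff.mpr fun h => hd (ringChar.dvd h)).squarefree
  have hA' : A.val ^ d = 1 := by rw [← Units.val_pow_eq_pow_val, hA, Units.val_one]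
  obtain ⟨m, b, C, hC⟩ := HasConstantMatrix.of_squarefree hsep (f := Matrix.toLin' A.val) (by
    simp [← Matrix.toLin'_pow, hA', Module.End.one_eq_id])
  let e : Fin m ≃ Fin n := b.indexEquiv (Pi.basisFun K[X] (Fin n))
  obtain rfl : m = n := by simpa using Fintype.card_congr e
  let c := Pi.basisFun K[X] (Fin m)
  let B : Matrix.GeneralLinearGroup (Fin m) K[X] :=
    ⟨c.toMatrix b, b.toMatrix c, c.toMatrix_mul_toMatrix_flip b, b.toMatrix_mul_toMatrix_flip c⟩
  have hB : (B⁻¹ * A * B).val = C.map Polynomial.C := by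
    rw [← hC, ← basis_toMatrix_mul_linearMap_toMatrix_mul_basis_toMatrix b c b c,
      ← Matrix.toLin_eq_toLin', LinearMap.toMatrix_toLin]
    rfl
  -- The constant `det C` is a unit in `K[t]`.
  have hdet : C.det ≠ 0 := by
    intro h
    have := Matrix.isUnits_det_units (B⁻¹ * A * B)
    rw [hB, ← RingHom.mapMatrix_apply, ← RingHom.map_det, h, map_zero] at this
    exact not_isUnit_zero this
  refine ⟨B, Matrix.GeneralLinearGroup.mkOfDetNeZero C hdet, Units.ext ?_⟩
  rw [hB]
  rfl

end ConstantMatrix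

/-! ### Linearized maps as matrices over `F[t]`. -/

section Frobenius

open MvPolynomial

namespace LinearizedMaps

section Linearized

variable {F : Type*} [Field F] [Fintype F] {n : ℕ}

/-- The action of `F[t]` on `F[X_1, …, X_n]` in which `t` acts as the Frobenius map. -/
noncomputable def frobeniusAction (F : Type*) [Field F] [Fintype F] (n : ℕ) :
    Polynomial F →ₐ[F] Module.End F (MvPolynomial (Fin n) F) :=
  Polynomial.aeval (FiniteField.frobeniusAlgHom F (MvPolynomial (Fin n) F)).toLinearMap

theorem frobeniusAction_monomial (m : ℕ) (a : F) (x : MvPolynomial (Fin n) F) :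
    frobeniusAction F n (Polynomial.monomial m a) x = a • x ^ Fintype.card F ^ m := by
  have h (k : ℕ) : ((FiniteField.frobeniusAlgHom F (MvPolynomial (Fin n) F)).toLinearMap ^ k) x =
      x ^ Fintype.card F ^ k := by
    induction k with
    | zero => simp
    | succ k ih => rw [pow_succ', Module.End.mul_apply, ih]; simp [pow_succ, pow_mul]
  simp [frobeniusAction, Polynomial.aeval_monomial, h, Algebra.algebraMap_eq_smul_one]

/-- Algebra homomorphisms preserve powers and scalars. Applied to substitution, this turns
composition into matrix multiplication. -/
theorem frobeniusAction_algHom (g : MvPolynomial (Fin n) F →ₐ[F] MvPolynomial (Fin n) F)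
    (p : Polynomial F) (x : MvPolynomial (Fin n) F) :
    g (frobeniusAction F n p x) = frobeniusAction F n p (g x) := by
  induction p using Polynomial.induction_on' with
  | add p q hp hq => simp [hp, hq]
  | monomial m a => simp [frobeniusAction_monomial]

/-- The polynomial map whose components are the linearized polynomials given by the rows of a
matrix over `F[t]`. -/
noncomputable def linearizedMap :
    Matrix (Fin n) (Fin n) (Polynomial F) →* PolyMap n F where
  toFun A := ⟨fun i => ∑ j, frobeniusAction F n (A i j) (X j)⟩
  map_one' := by
    ext1
    funext i
    change ∑ j, frobeniusAction F n ((1 : Matrix (Fin n) (Fin n) (Polynomial F)) i j) (X j) = X i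
    rw [Finset.sum_eq_single i (fun j _ h => by simp [Matrix.one_apply_ne' h]) (by simp)]
    simp
  map_mul' A B := by
    ext1
    funext i
    simp only [PolyMap.mul_comp, Matrix.mul_apply, map_sum, map_mul, frobeniusAction_algHom,
      bind₁_X_right, LinearMap.sum_apply, Module.End.mul_apply]
    exact Finset.sum_comm

theorem linearizedMap_comp (A : Matrix (Fin n) (Fin n) (Polynomial F)) (i : Fin n) :
    (linearizedMap A).comp i = ∑ j, frobeniusAction F n (A i j) (X j) := rfl

theorem linearizedMap_map_C (A : Matrix (Fin n) (Fin n) F) :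
    linearizedMap (A.map Polynomial.C) = PolyMap.linear A := by
  ext1
  funext i
  rw [linearizedMap_comp]
  refine Finset.sum_congr rfl fun j _ => ?_
  rw [Matrix.map_apply, ← Polynomial.monomial_zero_left, frobeniusAction_monomial, smul_eq_C_mul,
    pow_zero, pow_one]

/-- As `q > 1`, the monomials `X_j ^ q ^ m` are pairwise distinct, so the matrix entries can be read
off the polynomial map. -/
theorem coeff_frobeniusAction_X (p : Polynomial F) (i j : Fin n) (m : ℕ) :
    coeff (Finsupp.single j (Fintype.card F ^ m)) (frobeniusAction F n p (X i)) =
      if i = j then p.coeff m else 0 := by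
  have hinj := Nat.pow_right_injective (Fintype.one_lt_card (α := F))
  induction p using Polynomial.induction_on' with
  | add p q hp hq => rw [map_add, LinearMap.add_apply, coeff_add, hp, hq]; split_ifs <;> simp
  | monomial k a =>
    rw [frobeniusAction_monomial, coeff_smul, coeff_X_pow, Polynomial.coeff_monomial]
    have : (Finsupp.single i (Fintype.card F ^ k) = Finsupp.single j (Fintype.card F ^ m)) ↔
        i = j ∧ k = m := by
      rw [Finsupp.single_eq_single_iff]
      simp [Fintype.card_ne_zero, hinj.eq_iff]
    simp only [this]
    by_cases h : i = j <;> by_cases h' : k = m <;> simp [h, h']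

theorem linearizedMap_injective :
    Function.Injective (linearizedMap (F := F) (n := n)) := by
  intro A B h
  ext i j m
  have := congr(coeff (Finsupp.single j (Fintype.card F ^ m)) (($h).comp i))
  simpa [linearizedMap_comp, coeff_sum, coeff_frobeniusAction_X] using this

theorem exists_linearizedMap_eq {f : PolyMap n F}
    (hf : ∀ i, f.comp i ∈ linearizedPoly n F (Fintype.card F)) : ∃ A, linearizedMap A = f := by
  have h (p) (hp : p ∈ linearizedPoly n F (Fintype.card F)) :
      ∃ a : Fin n → Polynomial F, ∑ j, frobeniusAction F n (a j) (X j) = p := by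
    induction hp using Submodule.span_induction with
    | mem x hx =>
      obtain ⟨i, m, rfl⟩ := hx
      refine ⟨Pi.single i (Polynomial.monomial m 1), ?_⟩
      rw [Finset.sum_eq_single i (fun j _ h => by simp [h]) (by simp)]
      simp [frobeniusAction_monomial]
    | zero => exact ⟨0, by simp⟩
    | add x y _ _ hx hy =>
      obtain ⟨⟨a, rfl⟩, b, rfl⟩ := And.intro hx hy
      exact ⟨a + b, by simp [Finset.sum_add_distrib]⟩
    | smul c x _ hx =>
      obtain ⟨a, rfl⟩ := hx
      exact ⟨c • a, by simp [Finset.smul_sum]⟩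
  choose A hA using fun i => h _ (hf i)
  exact ⟨Matrix.of A, by ext1; funext i; exact hA i⟩

end Linearized

end LinearizedMaps

end Frobenius

/-! ### Transfer to automorphisms. -/

namespace LinearizedMaps

theorem isLinearizable_of_mem_linearizedGA {F : Type*} [Field F] [Fintype F] {n : ℕ} {f : GA n F}
    (hf : f ∈ linearizedGA n F (Fintype.card F)) (hfin : IsOfFinOrder f)
    (hcop : (orderOf f).Coprime (Fintype.card F)) : IsLinearizable f := by
  obtain ⟨A, hA⟩ := exists_linearizedMap_eq hf
  have hpow : A ^ orderOf f = 1 := by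
    apply linearizedMap_injective
    rw [map_pow, hA, ← Units.val_pow_eq_pow_val, pow_orderOf_eq_one, map_one, Units.val_one]
  let A' : Matrix.GeneralLinearGroup (Fin n) (Polynomial F) :=
    Units.ofPowEqOne A _ hpow hfin.orderOf_pos.ne'
  -- `q` is a positive power of the characteristic, which would be a common prime factor.
  have hchar : ¬ ringChar F ∣ orderOf f := fun h =>
    have : Fact (ringChar F).Prime := ⟨CharP.char_is_prime F _⟩
    (CharP.char_is_prime F _).one_lt.ne' <| Nat.eq_one_of_dvd_coprimes hcop h <| by
      obtain ⟨k, _, hk⟩ := FiniteField.card F (ringChar F)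
      exact hk ▸ dvd_pow_self _ k.ne_zero
  obtain ⟨B, C, h⟩ := exists_conj_eq_map_C A' (Units.pow_ofPowEqOne hpow _) hchar
  have hf' : Units.map linearizedMap A' = f := Units.ext hA
  have hC : Units.map linearizedMap
      (Matrix.GeneralLinearGroup.map (Polynomial.C : F →+* Polynomial F) C) = linearAut C :=
    Units.ext (linearizedMap_map_C C.val)
  refine ⟨C, isConj_iff.mpr ⟨(Units.map linearizedMap B)⁻¹, ?_⟩⟩
  rw [← hC, ← h, map_mul, map_mul, map_inv, hf', inv_inv]

end LinearizedMaps

theorem corollary4p17 :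
    (∀ (F : Type*) [Field F] [Finite F] (q : ℕ), Nat.card F = q →
      ∀ (n : ℕ) (f : LinearizedMaps.GA n F), f ∈ LinearizedMaps.linearizedGA n F q →
        ∀ d : ℕ, IsOfFinOrder f → orderOf f = d → Nat.gcd d q = 1 →
          LinearizedMaps.IsLinearizable f) ∧
    (∀ (K : Type*) [Field K] (n d : ℕ) (A : Matrix.GeneralLinearGroup (Fin n) (Polynomial K)),
      A ^ d = 1 → ¬ ringChar K ∣ d →
        ∃ (B : Matrix.GeneralLinearGroup (Fin n) (Polynomial K))
          (C : Matrix.GeneralLinearGroup (Fin n) K),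
          B⁻¹ * A * B = Matrix.GeneralLinearGroup.map (Polynomial.C : K →+* Polynomial K) C) := by
  refine ⟨?_, fun K _ n d A => exists_conj_eq_map_C A⟩
  rintro F _ _ q rfl n f hf d hfin rfl hcop
  have := Fintype.ofFinite F
  rw [Nat.card_eq_fintype_card] at hf hcop
  exact LinearizedMaps.isLinearizable_of_mem_linearizedGA hf hfin hcop
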